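/- Let $q$ be an odd prime power, let $\mathbb{F}_q$ be the field with $q$ elements, and let $C$ be the projective plane curve over $\mathbb{F}_q$ defined by the homogenization of the affine equation $$y+y^q+y^{q^2}+y^{q^3}+y^{q^4}+y^{q^5}=x+x^{q^2+q-1}.$$ (This is the case $n=6$, $d=2$ of the family $C_{q,n,d}$ given by $y+y^q+\cdots+y^{q^{n-1}}=x+x^q+\cdots+x^{q^{d-2}}+x^{q^{d-1}+q^d-1}$.) Then the number of $\mathbb{F}_{q^6}$-rational points of $C$ (including the unique point at infinity) is $$\#C(\mathbb{F}_{q^6}) = 1+q^{7}+(G-1)(q-1)q^{5},$$ where $$G=\begin{cases}21 & \text{if } q\equiv 19 \pmod{21},\\ 7 & \text{if } q\equiv 5 \pmod 7 \text{ and } q\not\equiv 1 \pmod 3,\\ 3 & \text{if } q\equiv 1 \pmod 3 \text{ and } q\not\equiv 5 \pmod 7,\\ 1 & \text{otherwise.}\end{cases}$$ -/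

import Mathlib

open scoped LinearAlgebra.Projectivization

namespace TwistedTrace

noncomputable section

/-- The homogenization of a polynomial `f(x, y)` in two variables (`x = X 0`, `y = X 1`): with
`e` the total degree of `f`, every monomial `x ^ i * y ^ j` is replaced by
`x ^ i * y ^ j * z ^ (e - i - j)`, where `z = X 2`. -/
def homogenization {F : Type*} [Field F] (f : MvPolynomial (Fin 2) F) :
    MvPolynomial (Fin 3) F :=
  ∑ m ∈ f.support, MvPolynomial.C (f.coeff m) *
    (MvPolynomial.X 0 ^ m 0 * MvPolynomial.X 1 ^ m 1 *
      MvPolynomial.X 2 ^ (f.totalDegree - (m 0 + m 1)))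

theorem homogenization_isHomogeneous {F : Type*} [Field F] (f : MvPolynomial (Fin 2) F) :
    (homogenization f).IsHomogeneous f.totalDegree := by
  refine MvPolynomial.IsHomogeneous.sum _ _ _ fun m hm => ?_
  have hle : m 0 + m 1 ≤ f.totalDegree := by
    have h := MvPolynomial.le_totalDegree hm
    rwa [Finsupp.sum_fintype _ _ (fun _ => rfl), Fin.sum_univ_two] at h
  have h := ((MvPolynomial.isHomogeneous_X_pow (R := F) (0 : Fin 3) (m 0)).mul
    (MvPolynomial.isHomogeneous_X_pow (1 : Fin 3) (m 1))).mul
    (MvPolynomial.isHomogeneous_X_pow (2 : Fin 3) (f.totalDegree - (m 0 + m 1)))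
  rw [Nat.add_sub_cancel' hle] at h
  exact h.C_mul _

/-- The polynomial `(y + y^q + ⋯ + y^(q^(n-1))) - R_d(x)` in `x = X 0` and `y = X 1`, where
`R_d(x) = x + x^q + ⋯ + x^(q^(d-2)) + x^(q^(d-1) + q^d - 1)`. -/
def affineEquation (F : Type*) [Field F] (q n d : ℕ) : MvPolynomial (Fin 2) F :=
  (∑ i ∈ Finset.range n, MvPolynomial.X 1 ^ q ^ i) -
    ((∑ i ∈ Finset.range (d - 1), MvPolynomial.X 0 ^ q ^ i) +
      MvPolynomial.X 0 ^ (q ^ (d - 1) + q ^ d - 1))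

/-- The set `C(K)` of `K`-rational points of the projective plane curve `C = C_{q,n,d}` over `F`,
the zero locus of the homogenization of `affineEquation F q n d`. The polynomial being
homogeneous, its vanishing at a point does not depend on the representative. -/
def rationalPoints (F K : Type*) [Field F] [Field K] [Algebra F K] (q n d : ℕ) :
    Set (ℙ K (Fin 3 → K)) :=
  {P | MvPolynomial.aeval P.rep (homogenization (affineEquation F q n d)) = 0}

/-- Vanishing may be tested on any representative. -/
theorem mk_mem_rationalPoints (F K : Type*) [Field F] [Field K] [Algebra F K] (q n d : ℕ)
    (v : Fin 3 → K) (hv : v ≠ 0) :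
    Projectivization.mk K v hv ∈ rationalPoints F K q n d ↔
      MvPolynomial.aeval v (homogenization (affineEquation F q n d)) = 0 := by
  obtain ⟨a, ha⟩ := Projectivization.exists_smul_eq_mk_rep K v hv
  have hom := homogenization_isHomogeneous (affineEquation F q n d)
  have key : MvPolynomial.aeval ((a : K) • v) (homogenization (affineEquation F q n d)) =
      (a : K) ^ (affineEquation F q n d).totalDegree *
        MvPolynomial.aeval v (homogenization (affineEquation F q n d)) := by
    simp only [MvPolynomial.aeval_def, MvPolynomial.eval₂_eq, Finset.mul_sum]
    refine Finset.sum_congr rfl fun m hm => ?_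
    have hd : ∑ i ∈ m.support, m i = (affineEquation F q n d).totalDegree := by
      have := hom (MvPolynomial.mem_support_iff.mp hm)
      simpa [Finsupp.weight_apply, Finsupp.sum] using this
    simp only [Pi.smul_apply, smul_eq_mul, mul_pow, Finset.prod_mul_distrib]
    rw [Finset.prod_pow_eq_pow_sum, hd]
    ring
  show MvPolynomial.aeval _ _ = 0 ↔ _
  rw [← ha, Units.smul_def, key, mul_eq_zero, or_iff_right (pow_ne_zero _ a.ne_zero)]

/-- The number `G` attached to `q`. -/
def bonusFactor (q : ℕ) : ℕ :=
  if q ≡ 19 [MOD 21] then 21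
  else if q ≡ 5 [MOD 7] ∧ ¬ q ≡ 1 [MOD 3] then 7
  else if q ≡ 1 [MOD 3] ∧ ¬ q ≡ 5 [MOD 7] then 3
  else 1

end

end TwistedTrace

/-!
The left side of the affine equation is the trace of `y` from `K` to `F`, a surjective `F`-linear
map with kernel of size `q ^ 5`, and the only point at infinity is `[1 : 0 : 0]`. So the number of
points is `1 + q ^ 5 * N`, where `N` is the number of `x` in `K` with
`c = x + x ^ (q ^ 2 + q - 1)` in `F` (`ncard_rationalPoints`, `ncard_trace_eq`).

Multiplying by `x` gives `x_0 ^ 2 + x_1 * x_2 = c * x_0` for the conjugates `x_i = x ^ (q ^ i)`,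
and the same with indices shifted modulo six. If `c = 0` and `x ≠ 0`, this says
`x ^ ((q - 1) * (q + 2)) = -1`. If `c ≠ 0`, one may divide by `c`, and the key fact
`third_eq_first_of_six_cycle` says that in any field with `2 ≠ 0` a nonzero solution of the six
equations `x_i ^ 2 + x_{i+1} * x_{i+2} = x_i` satisfies `x_2 = x_0`, that is, `x` lies in the
quadratic extension of `F`. Conversely both kinds of `x` satisfy the condition, so that `N` is found
by counting torsion in the cyclic group `Kˣ` (`ncard_add_pow_mem_range`); the factor `G` arises as
`gcd (q + 2, 21)`, because `1 + q + ⋯ + q ^ 5` takes the value `-21` at `q = -2`.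

The key fact is proved by elimination. In terms of the products `A, B, C` of opposite entries
`x_i`, `x_{i+3}` and of `α, β, γ`, one minus their sums, the equations become relations with cyclic
symmetry, among them `A * α = B * C - A ^ 2`. Subtracting opposite equations gives a homogeneous
linear system for the differences `x_i - x_{i+3}`. These are either all zero, a case settled
directly, or the determinant of the system vanishes. Passing to symmetric functions, the relations
either force `α = β = γ = 0` and `A = B = C`, which gives `x_2 = x_0`, or leave finitely many values
of `A + B + C`, excluded by `no_exceptional_values`.
-/

namespace TwistedTrace

/-! ### Cyclic quadratic relations of length six -/

/-- The last step of the elimination. Eliminating `m`, `e` and `w` from the other relations leaves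
a polynomial of degree five in `σ`, with factors `σ - 1`, `5 * σ ^ 2 + 6 * σ + 5` and
`σ ^ 2 + σ + 1`. On the three branches the relation `hS` becomes `16 * m = 0`, `2 * (σ - 1) = 0`
and `8 * m = 0` up to sign and powers of two, which is absurd as soon as two is invertible. -/
theorem no_exceptional_values {k : Type*} [Field k] (h2 : (2 : k) ≠ 0) {σ m e w : k}
    (hS : (e ^ 2 + 2 * σ * e) - 2 * (e * (e ^ 2 + 2 * σ * e) + σ * e * e + 3 * (m * e + σ * w)) +
      (e * (e * (e ^ 2 + 2 * σ * e) + σ * e * e + 3 * (m * e + σ * w)) +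
        σ * e * (e ^ 2 + 2 * σ * e) + (m * e + σ * w) * e) - 4 * (m * e - σ * w) -
      e * (1 - e - σ * e - (m * e + σ * w)) -
      2 * (σ * (1 - e - σ * e) + (1 - e) * w + (m * e - σ * w)) +
      σ * (3 - 2 * e + (e ^ 2 + 2 * σ * e)) - (σ - 2 * w + (m * e - σ * w)) = 0)
    (hw : w = 3 * m - σ ^ 2)
    (hs : (σ + 1) * e = 2) (hs0 : σ + 1 ≠ 0)
    (hm1 : m * (2 + 3 * (σ + 1) ^ 2) = σ ^ 2 * (σ + 1) ^ 2)
    (hwm : (σ + 1) ^ 2 * w = -(2 * m))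
    (hm2 : 7 * m * (σ + 1) = 4 * σ ^ 3 + σ ^ 2 - 1)
    (hσ3 : (σ - 1) * ((5 * σ ^ 2 + 6 * σ + 5) * (σ ^ 2 + σ + 1)) = 0) : False := by
  rcases mul_eq_zero.mp hσ3 with h | h
  · obtain rfl : σ = 1 := by linear_combination h
    obtain rfl : e = 1 := mul_left_cancel₀ h2 (by linear_combination hs)
    have hm : 7 * m = 2 := mul_left_cancel₀ h2 (by linear_combination hm2)
    subst hw
    have : (2 : k) ^ 5 = 0 := by linear_combination 7 * hS - 16 * hm
    exact h2 (pow_eq_zero_iff (by norm_num) |>.mp this)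
  rcases mul_eq_zero.mp h with h | h
  · have he : 2 * e = -(5 * σ + 1) :=
      mul_left_cancel₀ hs0 (by linear_combination 2 * hs + h)
    have hm5 : 5 * m = -2 * σ := by
      have : 2 * σ ^ 2 * (5 * m + 2 * σ) = 0 := by
        linear_combination -5 * hm1 + (5 * m - σ ^ 2) * h
      rcases mul_eq_zero.mp this with h0 | h0
      · obtain rfl : σ = 0 := by simpa [h2] using h0
        linear_combination m * h
      · linear_combination h0
    have h1 : σ * (w - 1) = 0 := by
      have : 2 ^ 2 * (σ * (w - 1)) = 0 := by linear_combination 5 * hwm - w * h - 2 * hm5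
      exact (mul_eq_zero.mp this).resolve_left (pow_ne_zero 2 h2)
    -- In characteristic five this is void, and `hm2` is needed to conclude `w = 1`.
    have h5 : 5 * (w - 1) = 0 := by linear_combination 5 * hw + 3 * hm5 - h
    have hw1 : w - 1 = 0 := by
      have : 2 * (w - 1) ^ 2 = 0 := by
        linear_combination 3 * ((w - 1) * hm2 - 7 * m * h1 + (4 * σ ^ 2 + σ) * h1 - m * h5) +
          2 * (w - 1) * hw - 2 * σ * h1 - h5
      simpa [h2] using this
    have hm : m = 2 * (1 + σ + σ ^ 2) := by linear_combination 2 * hw1 - 2 * hw - hm5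
    obtain rfl : w = 1 := by linear_combination hw1
    have he2 : e ^ 2 = 2 * e - 5 := by
      have : 2 ^ 2 * (e ^ 2 - 2 * e + 5) = 0 := by
        linear_combination e ^ 2 * h - (5 * (e * (σ + 1) + 2) - 4 * e) * hs
      have := (mul_eq_zero.mp this).resolve_left (pow_ne_zero 2 h2)
      linear_combination this
    have hse : σ * e = 2 - e := by linear_combination hs
    have : 2 ^ 4 * (2 * (σ - 1)) = 0 := by
      clear hσ3 h1 h5 hw1 hs
      grind
    have : σ - 1 = 0 := by simpa [h2] using this
    obtain rfl : σ = 1 := by linear_combination this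
    have : (2 : k) ^ 4 = 0 := by linear_combination h
    exact h2 (pow_eq_zero_iff (by norm_num) |>.mp this)
  · have he : e = -2 * σ := mul_left_cancel₀ hs0 (by linear_combination hs + 2 * h)
    have hm : m * (2 + 3 * σ) = 1 := by
      linear_combination hm1 + (σ^2 + σ - 1 - 3 * m) * h
    have hw' : w = -2 * m * σ ^ 2 := by
      linear_combination σ ^ 2 * hwm - (σ ^ 2 + σ - 1) * w * h
    have : 2 ^ 3 * m = 0 := by
      clear hσ3 hm2 hwm hw hs hm1
      grind
    rw [(mul_eq_zero.mp this).resolve_left (pow_ne_zero 3 h2)] at hm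
    simp at hm

/-- For a six-cycle `a, …, f` as in `third_eq_first_of_six_cycle`, the products of opposite entries
are `A = ad`, `B = be`, `C = cf`, and `α = 1 - a - d`, `β = 1 - b - e`, `γ = 1 - c - f`. The listed
relations are invariant under simultaneous cyclic permutation, so they can be rewritten in terms of
symmetric functions: `σ`, `m` of `A, B, C`, and `e` of `α, β, γ`, since `A * α = m - σ * A` turns
every mixed power sum into a polynomial in `σ`, `m`, `e`. -/
theorem eq_zero_of_cycle_products {k : Type*} [Field k] (h2 : (2 : k) ≠ 0) {A B C α β γ : k}
    (hA : A ≠ 0) (hB : B ≠ 0) (hC : C ≠ 0)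
    (hα : A * α = B * C - A ^ 2) (hβ : B * β = C * A - B ^ 2) (hγ : C * γ = A * B - C ^ 2)
    (hP : α * (1 - α) ^ 2 - 3 * A * α + A = C * (1 + γ))
    (hQ : β * (1 - β) ^ 2 - 3 * B * β + B = A * (1 + α))
    (hR : γ * (1 - γ) ^ 2 - 3 * C * γ + C = B * (1 + β))
    (hdet : 4 * (α * β * γ) + α * (1 - α) ^ 2 + β * (1 - β) ^ 2 + γ * (1 - γ) ^ 2 = 0)
    (hX : (2 * α * (1 - α) + 4 * A - (1 - β) * (1 - γ)) ^ 2 =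
      ((1 - β) ^ 2 - 4 * B) * ((1 - γ) ^ 2 - 4 * C))
    (hY : (2 * β * (1 - β) + 4 * B - (1 - γ) * (1 - α)) ^ 2 =
      ((1 - γ) ^ 2 - 4 * C) * ((1 - α) ^ 2 - 4 * A))
    (hZ : (2 * γ * (1 - γ) + 4 * C - (1 - α) * (1 - β)) ^ 2 =
      ((1 - α) ^ 2 - 4 * A) * ((1 - β) ^ 2 - 4 * B)) :
    α = 0 ∧ β = 0 ∧ γ = 0 ∧ A = B ∧ B = C := by
  have h4 : (4 : k) ≠ 0 := by
    have : (4 : k) = 2 * 2 := by norm_num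
    rw [this]; exact mul_ne_zero h2 h2
  obtain ⟨σ, hσ⟩ : ∃ σ, σ = A + B + C := ⟨_, rfl⟩
  obtain ⟨m, hm⟩ : ∃ m, m = A * B + B * C + C * A := ⟨_, rfl⟩
  obtain ⟨e, he⟩ : ∃ e, e = α + β + γ := ⟨_, rfl⟩
  obtain ⟨w, hw⟩ : ∃ w, w = 3 * m - σ ^ 2 := ⟨_, rfl⟩
  have a1 : A * α = m - σ * A := by rw [hα, hm, hσ]; ring
  have b1 : B * β = m - σ * B := by rw [hβ, hm, hσ]; ring
  have c1 : C * γ = m - σ * C := by rw [hγ, hm, hσ]; ring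
  have hABC : A * B * C ≠ 0 := mul_ne_zero (mul_ne_zero hA hB) hC
  -- elementary symmetric functions of `α, β, γ` and mixed power sums
  have e2 : α * β + β * γ + γ * α = -σ * e := by
    apply mul_left_cancel₀ hABC
    rw [he, hσ]
    linear_combination C * ((B * β) * hα + (B * C - A ^ 2) * hβ) +
      A * ((C * γ) * hβ + (C * A - B ^ 2) * hγ) + B * ((A * α) * hγ + (A * B - C ^ 2) * hα) +
      (A + B + C) * (B * C * hα + C * A * hβ + A * B * hγ)
  have e3 : α * β * γ = m * e + σ * w := by
    apply mul_left_cancel₀ hABC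
    rw [he, hw, hσ, hm]
    linear_combination (B * β) * (C * γ) * hα + (B * C - A ^ 2) * (C * γ) * hβ +
      (B * C - A ^ 2) * (C * A - B ^ 2) * hγ -
      (A * B + B * C + C * A) * (B * C * hα + C * A * hβ + A * B * hγ)
  have q1 : A * α + B * β + C * γ = w := by
    rw [a1, b1, c1, hw, hσ]; ring
  have q2 : A * α ^ 2 + B * β ^ 2 + C * γ ^ 2 = m * e - σ * w := by
    linear_combination α * a1 + β * b1 + γ * c1 - σ * q1 - m * he
  have p2 : α ^ 2 + β ^ 2 + γ ^ 2 = e ^ 2 + 2 * σ * e := by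
    rw [he] at e2 ⊢; linear_combination -2 * e2
  have q3 : A * α ^ 3 + B * β ^ 3 + C * γ ^ 3 =
      m * (e ^ 2 + 2 * σ * e) - σ * (m * e - σ * w) := by
    linear_combination α ^ 2 * a1 + β ^ 2 * b1 + γ ^ 2 * c1 - σ * q2 + m * p2
  have cub : ∀ x, x = α ∨ x = β ∨ x = γ →
      x ^ 3 = e * x ^ 2 + σ * e * x + (m * e + σ * w) := by
    rintro x (rfl | rfl | rfl)
    · linear_combination e3 - x * e2 - x ^ 2 * he
    · linear_combination e3 - x * e2 - x ^ 2 * he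
    · linear_combination e3 - x * e2 - x ^ 2 * he
  have cα := cub α (by simp)
  have cβ := cub β (by simp)
  have cγ := cub γ (by simp)
  have p3 : α ^ 3 + β ^ 3 + γ ^ 3 =
      e * (e ^ 2 + 2 * σ * e) + σ * e * e + 3 * (m * e + σ * w) := by
    linear_combination cα + cβ + cγ + e * p2 - σ * e * he
  have p4 : α ^ 4 + β ^ 4 + γ ^ 4 =
      e * (e * (e ^ 2 + 2 * σ * e) + σ * e * e + 3 * (m * e + σ * w)) +
        σ * e * (e ^ 2 + 2 * σ * e) + (m * e + σ * w) * e := by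
    linear_combination α * cα + β * cβ + γ * cγ + e * p3 + σ * e * p2 - (m * e + σ * w) * he
  -- the relations in symmetric form
  have S1 : e * ((e - 1) ^ 2 - 4 * σ + 3 * σ * e + 3 * m) + (3 * σ - 4) * w = 0 := by
    linear_combination hP + hQ + hR + 4 * q1 - p3 + 2 * p2 + he
  have S2 : m * e * (e + σ - 2) + σ * (σ - 1) * w = 0 := by
    subst hw hm hσ
    linear_combination A * hP + B * hQ + C * hR - q1 + 2 * q2 - q3 +
      3 * (A * a1 + B * b1 + C * c1) + (A * c1 + B * a1 + C * b1)
  have S3 : m * e + (σ + 1) * w = 0 := by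
    apply mul_left_cancel₀ h4
    linear_combination hdet - 4 * e3 - (hP + hQ + hR) - 4 * q1
  have t1 : A * (1 - β) * (1 - γ) + B * (1 - γ) * (1 - α) + C * (1 - α) * (1 - β) =
      σ * (1 - e - σ * e) + (1 - e) * w + (m * e - σ * w) := by
    rw [hσ, he] at *
    linear_combination (A + B + C) * e2 + (1 - α - β - γ) * q1 + q2
  have t2 : A * (1 - α) ^ 2 + B * (1 - β) ^ 2 + C * (1 - γ) ^ 2 =
      σ - 2 * w + (m * e - σ * w) := by
    linear_combination q2 - 2 * q1 - hσ
  have t3 : (1 - α) * (1 - β) * (1 - γ) = 1 - e - σ * e - (m * e + σ * w) := by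
    linear_combination e2 - e3 + he
  have hS : (e ^ 2 + 2 * σ * e) - 2 * (e * (e ^ 2 + 2 * σ * e) + σ * e * e + 3 * (m * e + σ * w)) +
      (e * (e * (e ^ 2 + 2 * σ * e) + σ * e * e + 3 * (m * e + σ * w)) +
        σ * e * (e ^ 2 + 2 * σ * e) + (m * e + σ * w) * e) - 4 * (m * e - σ * w) -
      e * (1 - e - σ * e - (m * e + σ * w)) -
      2 * (σ * (1 - e - σ * e) + (1 - e) * w + (m * e - σ * w)) +
      σ * (3 - 2 * e + (e ^ 2 + 2 * σ * e)) - (σ - 2 * w + (m * e - σ * w)) = 0 := by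
    have raw : (α ^ 2 + β ^ 2 + γ ^ 2) - 2 * (α ^ 3 + β ^ 3 + γ ^ 3) + (α ^ 4 + β ^ 4 + γ ^ 4) -
        4 * (A * α ^ 2 + B * β ^ 2 + C * γ ^ 2) - (α + β + γ) * ((1 - α) * (1 - β) * (1 - γ)) -
        2 * (A * (1 - β) * (1 - γ) + B * (1 - γ) * (1 - α) + C * (1 - α) * (1 - β)) +
        (A + B + C) * (3 - 2 * (α + β + γ) + (α ^ 2 + β ^ 2 + γ ^ 2)) -
        (A * (1 - α) ^ 2 + B * (1 - β) ^ 2 + C * (1 - γ) ^ 2) = 0 := by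
      apply mul_left_cancel₀ h4
      linear_combination hX + hY + hZ - 16 * (hα + hβ + hγ)
    rwa [p4, p3, q2, t3, t1, t2, p2, ← he, ← hσ] at raw
  -- If `w = 0`, all elementary symmetric functions of `α, β, γ` vanish.
  by_cases hw0 : w = 0
  · have hme : m * e = 0 := by linear_combination S3 - (σ + 1) * hw0
    have hall : α = 0 ∧ β = 0 ∧ γ = 0 := by
      rcases mul_eq_zero.mp hme with h0 | h0
      · have hs : σ = 0 := by
          have : σ ^ 2 = 0 := by linear_combination 3 * h0 - hw0 + hw
          exact pow_eq_zero_iff (two_ne_zero) |>.mp this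
        rw [h0, hs] at a1 b1 c1
        simp only [zero_mul, sub_zero, mul_eq_zero, hA, hB, hC, false_or] at a1 b1 c1
        exact ⟨a1, b1, c1⟩
      · have : ∀ x, x = α ∨ x = β ∨ x = γ → x = 0 := fun x hx => by
          have := cub x hx
          rw [h0, hw0] at this
          simpa using this
        exact ⟨this α (by simp), this β (by simp), this γ (by simp)⟩
    obtain ⟨rfl, rfl, rfl⟩ := hall
    refine ⟨rfl, rfl, rfl, ?_, ?_⟩
    · linear_combination -hQ
    · linear_combination -hR
  exfalso
  -- Otherwise eliminating `m * e` between `S2` and `S3` determines `e` in terms of `σ`.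
  have hs : (σ + 1) * e = 2 := by
    have : w * ((σ + 1) * e - 2) = 0 := by linear_combination (e + σ - 2) * S3 - S2
    rcases mul_eq_zero.mp this with h | h
    · exact absurd h hw0
    · linear_combination h
  have hm1 : m * (2 + 3 * (σ + 1) ^ 2) = σ ^ 2 * (σ + 1) ^ 2 := by
    linear_combination (σ + 1) * S3 - m * hs - (σ + 1) ^ 2 * hw
  have hs0 : σ + 1 ≠ 0 := by
    rintro h; rw [h, zero_mul] at hs; exact h2 hs.symm
  have hwm : (σ + 1) ^ 2 * w = - (2 * m) := by
    linear_combination (σ + 1) * S3 - m * hs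
  have hm2 : 7 * m * (σ + 1) = 4 * σ ^ 3 + σ ^ 2 - 1 := by
    apply mul_left_cancel₀ h2
    -- The last coefficient is the divided difference at `e * (σ + 1)` and `2` of a cubic
    -- polynomial, the expression of `(σ + 1) ^ 3 * S1` in terms of `e * (σ + 1)`.
    linear_combination (σ + 1) ^ 3 * S1 - (3 * σ - 4) * (σ + 1) * hwm -
      ((e * (σ + 1)) ^ 2 + 2 * (e * (σ + 1)) + 4 +
        (3 * σ - 2) * (σ + 1) * (e * (σ + 1) + 2) + (σ + 1) ^ 2 * (1 + 3 * m - 4 * σ)) * hs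
  have hσ3 : (σ - 1) * ((5 * σ ^ 2 + 6 * σ + 5) * (σ ^ 2 + σ + 1)) = 0 := by
    linear_combination 7 * (σ + 1) * hm1 - (2 + 3 * (σ + 1) ^ 2) * hm2
  exact no_exceptional_values h2 hS hw hs hs0 hm1 hwm hm2 hσ3

/-- A cyclic sequence of six nonzero elements with `x_i ^ 2 + x_{i+1} * x_{i+2} = x_i` has period
two, provided that two is invertible. -/
theorem third_eq_first_of_six_cycle {k : Type*} [Field k] (h2 : (2 : k) ≠ 0) {a b c d e f : k}
    (ha : a ≠ 0) (hb : b ≠ 0) (hc : c ≠ 0) (hd : d ≠ 0) (he : e ≠ 0) (hf : f ≠ 0)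
    (Ea : a ^ 2 + b * c = a) (Eb : b ^ 2 + c * d = b) (Ec : c ^ 2 + d * e = c)
    (Ed : d ^ 2 + e * f = d) (Ee : e ^ 2 + f * a = e) (Ef : f ^ 2 + a * b = f) : c = a := by
  by_cases hδ : a = d ∧ b = e ∧ c = f
  · obtain ⟨rfl, rfl, rfl⟩ := hδ
    by_contra hca
    have h1 : 1 - a - c = -b := by
      have : (c - a) * (1 - a - c + b) = 0 := by linear_combination Ea - Ec
      have := (mul_eq_zero.mp this).resolve_left (sub_ne_zero.mpr hca)
      linear_combination this
    have h3 : (b - a) * (1 - a - b + c) = 0 := by linear_combination Ea - Eb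
    rcases mul_eq_zero.mp h3 with h | h
    · obtain rfl : b = a := by linear_combination h
      have hbb : b * b = 0 := by linear_combination Ec + c * h1
      exact mul_ne_zero hb hb hbb
    · have hbc : b = c := mul_left_cancel₀ h2 (by linear_combination h1 - h)
      subst hbc
      have : b * b = 0 := by linear_combination Ea + a * h1
      exact mul_ne_zero hb hb this
  -- Differences of opposite equations are linear in `a - d`, `b - e`, `c - f`.
  have R1 : 2 * (1 - a - d) * (a - d) - (c + f) * (b - e) - (b + e) * (c - f) = 0 := by
    linear_combination 2 * Ed - 2 * Ea
  have R2 : (c + f) * (a - d) + 2 * (1 - b - e) * (b - e) - (a + d) * (c - f) = 0 := by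
    linear_combination 2 * Ee - 2 * Eb
  have R3 : (b + e) * (a - d) + (a + d) * (b - e) + 2 * (1 - c - f) * (c - f) = 0 := by
    linear_combination 2 * Ef - 2 * Ec
  -- The differences are not all zero, so the determinant of the system vanishes.
  have hdet : 4 * ((1 - a - d) * (1 - b - e) * (1 - c - f)) +
      (1 - a - d) * (1 - (1 - a - d)) ^ 2 + (1 - b - e) * (1 - (1 - b - e)) ^ 2 +
      (1 - c - f) * (1 - (1 - c - f)) ^ 2 = 0 := by
    by_contra hD
    refine hδ ⟨?_, ?_, ?_⟩
    · refine sub_eq_zero.mp (mul_left_cancel₀ h2 (mul_left_cancel₀ hD ?_))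
      linear_combination (4 * (1 - b - e) * (1 - c - f) + (a + d) ^ 2) * R1 -
        ((a + d) * (b + e) - 2 * (1 - c - f) * (c + f)) * R2 +
        ((c + f) * (a + d) + 2 * (1 - b - e) * (b + e)) * R3
    · refine sub_eq_zero.mp (mul_left_cancel₀ h2 (mul_left_cancel₀ hD ?_))
      linear_combination -((a + d) * (b + e) + 2 * (1 - c - f) * (c + f)) * R1 +
        (4 * (1 - a - d) * (1 - c - f) + (b + e) ^ 2) * R2 -
        ((b + e) * (c + f) - 2 * (1 - a - d) * (a + d)) * R3
    · refine sub_eq_zero.mp (mul_left_cancel₀ h2 (mul_left_cancel₀ hD ?_))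
      linear_combination ((c + f) * (a + d) - 2 * (1 - b - e) * (b + e)) * R1 -
        ((b + e) * (c + f) + 2 * (1 - a - d) * (a + d)) * R2 +
        (4 * (1 - a - d) * (1 - b - e) + (c + f) ^ 2) * R3
  have key := eq_zero_of_cycle_products h2 (A := a * d) (B := b * e) (C := c * f) (α := 1 - a - d)
    (β := 1 - b - e) (γ := 1 - c - f) (mul_ne_zero ha hd) (mul_ne_zero hb he) (mul_ne_zero hc hf)
    (by linear_combination -(d - d ^ 2) * Ea - b * c * Ed)
    (by linear_combination -(e - e ^ 2) * Eb - c * d * Ee)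
    (by linear_combination -(f - f ^ 2) * Ec - d * e * Ef)
    (by linear_combination f * Ec + c * Ef - a * Ea - d * Ed)
    (by linear_combination a * Ed + d * Ea - b * Eb - e * Ee)
    (by linear_combination b * Ee + e * Eb - c * Ec - f * Ef)
    hdet
    (by
      have : (b - e) * (c - f) =
          2 * (1 - a - d) * (1 - (1 - a - d)) + 4 * (a * d) - (1 - (1 - b - e)) * (1 - (1 - c - f)) := by
        linear_combination 2 * Ea + 2 * Ed
      rw [← this]; ring)
    (by
      have : (c - f) * (d - a) =
          2 * (1 - b - e) * (1 - (1 - b - e)) + 4 * (b * e) - (1 - (1 - c - f)) * (1 - (1 - a - d)) := by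
        linear_combination 2 * Eb + 2 * Ee
      rw [← this]; ring)
    (by
      have : (a - d) * (b - e) =
          2 * (1 - c - f) * (1 - (1 - c - f)) + 4 * (c * f) - (1 - (1 - a - d)) * (1 - (1 - b - e)) := by
        linear_combination 2 * Ec + 2 * Ef
      rw [← this]; ring)
  obtain ⟨hα, hβ, hγ, hAB, hBC⟩ := key
  have hce : c = e := mul_left_cancel₀ hb (by linear_combination Ea + a * hα + hAB)
  have hbf : b = f := mul_left_cancel₀ he (by linear_combination hBC + f * hce)
  have hdf : d = f := mul_left_cancel₀ hc (by linear_combination Eb + b * hβ + hBC)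
  linear_combination hα - hγ + hdf

/-! ### Greatest common divisors and torsion in a cyclic group -/

/-- The solutions form a coset of the `n`-torsion of the cyclic group `Kˣ`. -/
theorem ncard_pow_eq_pow {K : Type*} [Field K] [Finite K] {a : K} (ha : a ≠ 0) (n : ℕ) :
    {x : K | x ≠ 0 ∧ x ^ n = a ^ n}.ncard = (Nat.card K - 1).gcd n := by
  have hset : {x : K | x ≠ 0 ∧ x ^ n = a ^ n} =
      (fun u : Kˣ => a * (u : K)) '' ((powMonoidHom n : Kˣ →* Kˣ).ker : Set Kˣ) := by
    ext x
    simp only [Set.mem_ofPred_eq, Set.mem_image, SetLike.mem_coe, MonoidHom.mem_ker,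
      powMonoidHom_apply]
    constructor
    · rintro ⟨hx, h⟩
      refine ⟨Units.mk0 (x / a) (div_ne_zero hx ha), ?_, ?_⟩
      · ext; simp [div_pow, h, ha]
      · simp; field_simp
    · rintro ⟨u, hu, rfl⟩
      refine ⟨mul_ne_zero ha u.ne_zero, ?_⟩
      rw [mul_pow, ← Units.val_pow_eq_pow_val, hu, Units.val_one, mul_one]
  have hinj : Function.Injective (fun u : Kˣ => a * (u : K)) := fun u v h =>
    Units.ext (mul_left_cancel₀ ha h)
  rw [hset, Set.ncard_image_of_injective _ hinj, ← Nat.card_coe_set_eq, SetLike.coe_sort_coe,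
    IsCyclic.card_powMonoidHom_ker, Nat.card_units]

theorem bonusFactor_eq_gcd (q : ℕ) : bonusFactor q = Nat.gcd (q + 2) 21 := by
  have h : Nat.gcd (q + 2) 21 = Nat.gcd (q % 21 + 2) 21 := by
    rw [Nat.gcd_comm, Nat.gcd_comm _ 21, Nat.gcd_rec 21, Nat.gcd_rec 21 (q % 21 + 2)]
    simp
  have hlt : q % 21 < 21 := Nat.mod_lt _ (by norm_num)
  have h7 : q % 7 = q % 21 % 7 := by omega
  have h3 : q % 3 = q % 21 % 3 := by omega
  rw [h]
  simp only [bonusFactor, Nat.ModEq, h7, h3]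
  clear h h7 h3
  generalize q % 21 = r at *
  interval_cases r <;> rfl

/-- Modulo `q + 2` the sum is its value `-21` at `q = -2`. -/
theorem geomSum_six_gcd (q : ℕ) :
    (1 + q + q ^ 2 + q ^ 3 + q ^ 4 + q ^ 5).gcd (q + 2) = (q + 2).gcd 21 := by
  have key : (1 + q + q ^ 2 + q ^ 3 + q ^ 4 + q ^ 5) + (21 + (q + 2) * (q ^ 3 + 5 * q)) =
      (q + 2) * (q ^ 4 + 3 * q ^ 2 + 11) := by ring
  apply Nat.dvd_antisymm
  · apply Nat.dvd_gcd (Nat.gcd_dvd_right _ _)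
    have h1 := Nat.gcd_dvd_left (1 + q + q ^ 2 + q ^ 3 + q ^ 4 + q ^ 5) (q + 2)
    have h2 := Nat.gcd_dvd_right (1 + q + q ^ 2 + q ^ 3 + q ^ 4 + q ^ 5) (q + 2)
    have h3 := (Nat.dvd_add_right h1).mp (key ▸ h2.mul_right (q ^ 4 + 3 * q ^ 2 + 11))
    exact (Nat.dvd_add_left (h2.mul_right _)).mp h3
  · refine Nat.dvd_gcd ?_ (Nat.gcd_dvd_left _ _)
    have h1 := Nat.gcd_dvd_left (q + 2) 21
    have h2 := Nat.gcd_dvd_right (q + 2) 21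
    exact (Nat.dvd_add_left (h2.add (h1.mul_right _))).mp
      (key ▸ h1.mul_right (q ^ 4 + 3 * q ^ 2 + 11))

/-! ### Elements with value in the base field -/

section Frobenius

variable {F K : Type*} [Field F] [Finite F] [Field K] [Algebra F K] {q : ℕ}

theorem exists_frobenius (K : Type*) [Field K] [Algebra F K] (hq : Nat.card F = q) :
    ∃ φ : K →ₐ[F] K, ∀ x, φ x = x ^ q := by
  have := Fintype.ofFinite F
  refine ⟨FiniteField.frobeniusAlgHom F K, fun x => ?_⟩
  rw [FiniteField.coe_frobeniusAlgHom, Fintype.card_eq_nat_card, hq]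

theorem mem_range_algebraMap_iff_pow_eq [Finite K] (hq : Nat.card F = q) (x : K) :
    x ∈ Set.range (algebraMap F K) ↔ x ^ q = x := by
  have := Fintype.ofFinite F
  have hFc : Fintype.card F = q := by rw [Fintype.card_eq_nat_card, hq]
  constructor
  · rintro ⟨c, rfl⟩
    rw [← map_pow, ← hFc, FiniteField.pow_card]
  · intro h
    rw [IsGalois.mem_range_algebraMap_iff_fixed]
    intro g
    obtain ⟨i, rfl⟩ := (FiniteField.bijective_frobeniusAlgEquivOfAlgebraic_pow F K).2 g
    have hx : FiniteField.frobeniusAlgEquivOfAlgebraic F K x = x := by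
      rw [FiniteField.coe_frobeniusAlgEquivOfAlgebraic, hFc]; exact h
    simp only
    induction (i : ℕ) with
    | zero => simp
    | succ n ih => rw [pow_succ, AlgEquiv.mul_apply, hx, ih]

theorem two_ne_zero_of_odd_card (hq : Nat.card F = q) (hodd : Odd q) : (2 : K) ≠ 0 := by
  have := Fintype.ofFinite F
  have hF : ringChar F ≠ 2 := fun h => by
    have := FiniteField.even_card_of_char_two h
    rw [Fintype.card_eq_nat_card, hq] at this
    exact (Nat.not_even_iff_odd.mpr hodd) (Nat.even_iff.mpr this)
  have h2 : (2 : F) ≠ 0 := Ring.two_ne_zero hF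
  have h := (map_ne_zero (algebraMap F K)).mpr h2
  rwa [map_ofNat] at h

/-- If `c = x + x ^ (q ^ 2 + q - 1)` lies in `F` and is nonzero, then the conjugates of `x / c`
form a six-cycle as in `third_eq_first_of_six_cycle`; if `c = 0`, then `x ^ (q ^ 2 + q - 2) = -1`. -/
theorem pow_sq_eq_self_or_pow_eq_neg_one [Finite K] (hq : Nat.card F = q) (hodd : Odd q)
    (hK : Module.finrank F K = 6) {x : K} (hx : x ≠ 0)
    (h : x + x ^ (q ^ 2 + q - 1) ∈ Set.range (algebraMap F K)) :
    x ^ q ^ 2 = x ∨ x ^ ((q - 1) * (q + 2)) = -1 := by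
  obtain ⟨c, hc⟩ := h
  obtain ⟨φ, hφ⟩ := exists_frobenius K hq
  have hqpos : 0 < q := hodd.pos
  have h2 : (2 : K) ≠ 0 := two_ne_zero_of_odd_card hq hodd
  have hφ2 : ∀ y : K, φ (φ y) = y ^ q ^ 2 := fun y => by rw [hφ, hφ, ← pow_mul, sq]
  have hφ6 : ∀ y : K, φ (φ (φ (φ (φ (φ y))))) = y := fun y => by
    have := Fintype.ofFinite K
    have hcard : Fintype.card K = q ^ 6 := by
      rw [Fintype.card_eq_nat_card, Module.natCard_eq_pow_finrank (K := F), hq, hK]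
    simp only [hφ, ← pow_mul]
    have := FiniteField.pow_card y
    rw [hcard] at this
    convert this using 2
    ring
  have hmul : x ^ 2 + φ x * φ (φ x) = algebraMap F K c * x := by
    rw [hc, hφ2, hφ, ← pow_add, add_mul, ← pow_succ, sq x]
    congr 2
    omega
  by_cases hc0 : c = 0
  · right
    rw [hc0, map_zero, zero_mul, hφ2, hφ] at hmul
    obtain ⟨n, rfl⟩ : ∃ n, q = n + 1 := ⟨q - 1, by omega⟩
    apply mul_right_cancel₀ (pow_ne_zero 2 hx)
    rw [← pow_add, neg_one_mul, ← eq_neg_of_add_eq_zero_right hmul, ← pow_add]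
    congr 1
    simp only [Nat.add_sub_cancel]
    ring
  · left
    have hc0' : algebraMap F K c ≠ 0 := by simpa using hc0
    obtain ⟨y, hy⟩ : ∃ y, y = x / algebraMap F K c := ⟨_, rfl⟩
    have hxy : x = algebraMap F K c * y := by rw [hy]; field_simp
    have E : ∀ z, z ^ 2 + φ z * φ (φ z) = z → φ z ^ 2 + φ (φ z) * φ (φ (φ z)) = φ z := by
      intro z hz
      have := congrArg φ hz
      simpa only [map_add, map_mul, map_pow] using this
    have E0 : y ^ 2 + φ y * φ (φ y) = y := by
      rw [hxy] at hmul
      simp only [map_mul, AlgHom.commutes] at hmul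
      apply mul_left_cancel₀ (pow_ne_zero 2 hc0')
      linear_combination hmul
    have hy0 : y ≠ 0 := by rw [hy]; exact div_ne_zero hx hc0'
    have N : ∀ z : K, z ≠ 0 → φ z ≠ 0 := fun z hz => by simpa using hz
    have E1 := E _ E0
    have E2 := E _ E1
    have E3 := E _ E2
    have E4 := E _ E3
    have E5 := E _ E4
    rw [hφ6] at E4 E5
    have key := third_eq_first_of_six_cycle h2 hy0 (N _ hy0) (N _ (N _ hy0)) (N _ (N _ (N _ hy0)))
      (N _ (N _ (N _ (N _ hy0)))) (N _ (N _ (N _ (N _ (N _ hy0))))) E0 E1 E2 E3 E4 E5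
    rw [← hφ2, hxy, map_mul, map_mul, AlgHom.commutes, AlgHom.commutes, key]

theorem add_pow_mem_range_algebraMap_iff [Finite K] (hq : Nat.card F = q) (hodd : Odd q)
    (hK : Module.finrank F K = 6) {x : K} (hx : x ≠ 0) :
    x + x ^ (q ^ 2 + q - 1) ∈ Set.range (algebraMap F K) ↔
      x ^ (q ^ 2 - 1) = 1 ∨ x ^ ((q - 1) * (q + 2)) = -1 := by
  have hqpos : 0 < q := hodd.pos
  have hsq : x ^ q ^ 2 = x ↔ x ^ (q ^ 2 - 1) = 1 := by
    rw [← mul_left_inj' hx (a := x ^ (q ^ 2 - 1)), ← pow_succ, one_mul,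
      Nat.sub_add_cancel (Nat.one_le_pow _ _ hqpos)]
  rw [← hsq]
  refine ⟨pow_sq_eq_self_or_pow_eq_neg_one hq hodd hK hx, ?_⟩
  have hmul : x * (x + x ^ (q ^ 2 + q - 1)) = x ^ 2 + x ^ q ^ 2 * x ^ q := by
    rw [← pow_add, mul_add, ← pow_succ', sq x]
    congr 2
    omega
  rintro (h | h)
  · have : x + x ^ (q ^ 2 + q - 1) = x + x ^ q := by
      apply mul_left_cancel₀ hx
      rw [hmul, h]; ring
    obtain ⟨φ, hφ⟩ := exists_frobenius K hq
    rw [this, mem_range_algebraMap_iff_pow_eq hq, ← hφ, map_add, hφ, hφ, ← pow_mul, ← sq, h,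
      add_comm]
  · refine ⟨0, ?_⟩
    rw [map_zero]
    symm
    apply (mul_eq_zero.mp (hmul.trans ?_)).resolve_left hx
    obtain ⟨n, rfl⟩ : ∃ n, q = n + 1 := ⟨q - 1, by omega⟩
    have : x ^ (n + 1) ^ 2 * x ^ (n + 1) = x ^ ((n + 1 - 1) * (n + 1 + 2)) * x ^ 2 := by
      rw [← pow_add, ← pow_add]
      congr 1
      simp only [Nat.add_sub_cancel]
      ring
    rw [this, h]; ring

/-- Apart from `0`, the set is the union of `{x ^ (q ^ 2 - 1) = 1}` and
`{x ^ ((q - 1) * (q + 2)) = -1}`, which meet in `{x ^ (q - 1) = -1}`; the three are cosets of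
torsion subgroups of `Kˣ`. -/
theorem ncard_add_pow_mem_range [Finite K] (hq : Nat.card F = q) (hodd : Odd q)
    (hK : Module.finrank F K = 6) :
    {x : K | x + x ^ (q ^ 2 + q - 1) ∈ Set.range (algebraMap F K)}.ncard =
      q ^ 2 + ((q + 2).gcd 21 - 1) * (q - 1) := by
  have hqpos : 0 < q := hodd.pos
  have hq1 : 1 < q := by rw [← hq]; exact Finite.one_lt_card
  have hcard : Nat.card K = q ^ 6 := by rw [Module.natCard_eq_pow_finrank (K := F), hq, hK]
  have h2 : (2 : K) ≠ 0 := two_ne_zero_of_odd_card hq hodd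
  obtain ⟨n, rfl⟩ : ∃ n, q = n + 1 := ⟨q - 1, by omega⟩
  obtain ⟨s, hs⟩ : ∃ s, s = 1 + (n + 1) + (n + 1) ^ 2 + (n + 1) ^ 3 + (n + 1) ^ 4 + (n + 1) ^ 5 :=
    ⟨_, rfl⟩
  have hN : Nat.card K - 1 = n * s := by
    rw [hcard, hs]; apply Nat.sub_eq_of_eq_add; ring
  have hodd2 : Even n := by
    rcases Nat.even_or_odd n with h | h
    · exact h
    · exact absurd hodd (by simpa using h.add_one)
  have hs2 : 2 ∣ s := by
    rw [hs]
    refine ⟨(1 + (n + 1) ^ 2 + (n + 1) ^ 4) * (n / 2 + 1), ?_⟩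
    obtain ⟨k, rfl⟩ := hodd2
    rw [← two_mul, Nat.mul_div_cancel_left _ two_pos]; ring
  -- Some element has `(q - 1)`-st power `-1`: there are `2 * (q - 1)` solutions of
  -- `x ^ (2 * (q - 1)) = 1`, and only `q - 1` of them satisfy `x ^ (q - 1) = 1`.
  obtain ⟨a, ha0, ha⟩ : ∃ a : K, a ≠ 0 ∧ a ^ n = -1 := by
    by_contra! hcon
    have hsub : {x : K | x ≠ 0 ∧ x ^ (n * 2) = 1 ^ (n * 2)} ⊆ {x : K | x ≠ 0 ∧ x ^ n = 1 ^ n} := by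
      rintro x ⟨hx, h⟩
      refine ⟨hx, ?_⟩
      rw [one_pow, pow_mul, sq, mul_self_eq_one_iff] at h
      rw [one_pow]
      exact h.resolve_right (hcon x hx)
    have := Set.ncard_le_ncard hsub
    rw [ncard_pow_eq_pow one_ne_zero, ncard_pow_eq_pow one_ne_zero, hN, Nat.gcd_mul_left,
      Nat.gcd_eq_right hs2, Nat.gcd_eq_right (Dvd.intro _ rfl)] at this
    omega
  have hapow : a ^ (n * (n + 3)) = -1 := by
    rw [pow_mul, ha, (hodd2.add_odd (by decide)).neg_one_pow]
  have hset : {x : K | x + x ^ ((n + 1) ^ 2 + (n + 1) - 1) ∈ Set.range (algebraMap F K)} =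
      insert 0 ({x : K | x ≠ 0 ∧ x ^ (n * (n + 2)) = 1 ^ (n * (n + 2))} ∪
        {x : K | x ≠ 0 ∧ x ^ (n * (n + 3)) = a ^ (n * (n + 3))}) := by
    ext x
    by_cases hx : x = 0
    · subst hx
      have : (n + 1) ^ 2 + (n + 1) - 1 ≠ 0 := by
        have := Nat.pow_pos (n := 2) hqpos
        omega
      simp only [Set.mem_insert_iff, true_or, iff_true, Set.mem_ofPred_eq, zero_pow this, add_zero]
      exact ⟨0, map_zero _⟩
    · simp only [Set.mem_insert_iff, Set.mem_union, Set.mem_ofPred_eq, hx, false_or, ne_eq,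
        not_false_eq_true, true_and, one_pow]
      rw [add_pow_mem_range_algebraMap_iff hq hodd hK hx, hapow]
      have h1 : (n + 1) ^ 2 - 1 = n * (n + 2) := by
        apply Nat.sub_eq_of_eq_add; ring
      rw [h1, Nat.add_sub_cancel, add_assoc n 1 2]
  have hinter : {x : K | x ≠ 0 ∧ x ^ (n * (n + 2)) = 1 ^ (n * (n + 2))} ∩
        {x : K | x ≠ 0 ∧ x ^ (n * (n + 3)) = a ^ (n * (n + 3))} =
      {x : K | x ≠ 0 ∧ x ^ n = a ^ n} := by
    ext x
    simp only [Set.mem_inter_iff, Set.mem_ofPred_eq, one_pow, hapow, ha]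
    constructor
    · rintro ⟨⟨hx, h1⟩, -, h2⟩
      refine ⟨hx, ?_⟩
      rwa [show n * (n + 3) = n * (n + 2) + n by ring, pow_add, h1, one_mul] at h2
    · rintro ⟨hx, h⟩
      refine ⟨⟨hx, ?_⟩, hx, ?_⟩
      · rw [pow_mul, h, (hodd2.add even_two).neg_one_pow]
      · rw [pow_mul, h, (hodd2.add_odd (by decide)).neg_one_pow]
  have hcount := Set.ncard_union_add_ncard_inter
    {x : K | x ≠ 0 ∧ x ^ (n * (n + 2)) = 1 ^ (n * (n + 2))}
    {x : K | x ≠ 0 ∧ x ^ (n * (n + 3)) = a ^ (n * (n + 3))}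
  have hdvd : n + 2 ∣ s := ⟨1 + (n + 1) ^ 2 + (n + 1) ^ 4, by rw [hs]; ring⟩
  have hgcd : s.gcd (n + 3) = (n + 1 + 2).gcd 21 := by rw [hs]; exact geomSum_six_gcd (n + 1)
  rw [hinter, ncard_pow_eq_pow one_ne_zero, ncard_pow_eq_pow ha0, ncard_pow_eq_pow ha0, hN,
    Nat.gcd_mul_left, Nat.gcd_mul_left, Nat.gcd_eq_right hdvd, Nat.gcd_eq_right (Dvd.intro _ rfl),
    hgcd] at hcount
  rw [hset, Set.ncard_insert_of_notMem (by simp)]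
  obtain ⟨g, hg⟩ : ∃ g, (n + 1 + 2).gcd 21 = g + 1 :=
    ⟨_, (Nat.succ_pred_eq_of_pos (Nat.gcd_pos_of_pos_right _ (by norm_num))).symm⟩
  rw [hg] at hcount ⊢
  simp only [Nat.add_sub_cancel]
  linarith [mul_comm g n]
/-- The left side of the equation is the trace of `K` over `F`, whose fibres all have `q ^ 5`
elements. -/
theorem ncard_trace_eq [Finite K] (hq : Nat.card F = q) (hK : Module.finrank F K = 6)
    (f : K → K) :
    {p : K × K | ∑ i ∈ Finset.range 6, p.2 ^ q ^ i = f p.1}.ncard =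
      q ^ 5 * {x : K | f x ∈ Set.range (algebraMap F K)}.ncard := by
  have hker : (LinearMap.ker (Algebra.trace F K) : Set K).ncard = q ^ 5 := by
    have h := (Algebra.trace F K).finrank_range_add_finrank_ker
    rw [LinearMap.range_eq_top.mpr (Algebra.trace_surjective F K), finrank_top,
      Module.finrank_self, hK] at h
    rw [← Nat.card_coe_set_eq, SetLike.coe_sort_coe, Module.natCard_eq_pow_finrank (K := F), hq,
      show Module.finrank F (LinearMap.ker (Algebra.trace F K)) = 5 by omega]
  have hsum : ∀ y : K, ∑ i ∈ Finset.range 6, y ^ q ^ i =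
      algebraMap F K (Algebra.trace F K y) := fun y => by
    rw [FiniteField.algebraMap_trace_eq_sum_pow, hK, hq]
  have hsection : ∀ x : K, ∃ y : K, f x ∈ Set.range (algebraMap F K) →
      algebraMap F K (Algebra.trace F K y) = f x := fun x => by
    by_cases hx : f x ∈ Set.range (algebraMap F K)
    · obtain ⟨c, hc⟩ := hx
      obtain ⟨y, hy⟩ := Algebra.trace_surjective F K c
      exact ⟨y, fun _ => by rw [hy, hc]⟩
    · exact ⟨0, fun h => absurd h hx⟩
  choose g hg using hsection
  have hset : {p : K × K | ∑ i ∈ Finset.range 6, p.2 ^ q ^ i = f p.1} =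
      (fun p : K × K => (p.2, p.1 + g p.2)) ''
        ((LinearMap.ker (Algebra.trace F K) : Set K) ×ˢ
          {x : K | f x ∈ Set.range (algebraMap F K)}) := by
    ext ⟨x, y⟩
    simp only [Set.mem_ofPred_eq, Set.mem_image, Set.mem_prod, SetLike.mem_coe, LinearMap.mem_ker,
      hsum, Prod.exists, Prod.mk.injEq]
    constructor
    · intro h
      have hx : f x ∈ Set.range (algebraMap F K) := ⟨_, h⟩
      refine ⟨y - g x, x, ⟨?_, hx⟩, rfl, sub_add_cancel _ _⟩
      apply (algebraMap F K).injective
      rw [map_sub, map_sub, h, hg x hx, sub_self, map_zero]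
    · rintro ⟨z, x', ⟨hz, hx⟩, rfl, rfl⟩
      rw [map_add, hz, zero_add, hg _ hx]
  have hinj : Function.Injective fun p : K × K => (p.2, p.1 + g p.2) := by
    rintro ⟨z, x⟩ ⟨z', x'⟩ h
    obtain ⟨rfl, h⟩ := Prod.mk.inj h
    exact Prod.ext (add_right_cancel h) rfl
  rw [hset, Set.ncard_image_of_injective _ hinj, Set.ncard_prod, hker]

end Frobenius

/-! ### Points of the projective curve -/

section Homogenization

variable {F K : Type*} [Field F] [Field K] [Algebra F K]

theorem aeval_homogenization_of_eq_one (f : MvPolynomial (Fin 2) F) {v : Fin 3 → K}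
    (hv : v 2 = 1) :
    MvPolynomial.aeval v (homogenization f) =
      MvPolynomial.aeval ![v 0, v 1] f := by
  rw [homogenization, map_sum, MvPolynomial.aeval_def ![v 0, v 1],
    MvPolynomial.eval₂_eq']
  refine Finset.sum_congr rfl fun m _ => ?_
  simp [hv, Fin.prod_univ_two]

theorem aeval_homogenization_of_eq_zero (f : MvPolynomial (Fin 2) F) {v : Fin 3 → K}
    (hv : v 2 = 0) :
    MvPolynomial.aeval v (homogenization f) =
      MvPolynomial.aeval ![v 0, v 1] (MvPolynomial.homogeneousComponent f.totalDegree f) := by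
  rw [homogenization, MvPolynomial.homogeneousComponent_apply, map_sum, map_sum,
    Finset.sum_filter]
  refine Finset.sum_congr rfl fun m hm => ?_
  have hdeg : m.degree = m 0 + m 1 := by
    rw [Finsupp.degree_eq_sum, Fin.sum_univ_two]
  have hle : m 0 + m 1 ≤ f.totalDegree := by
    have h := MvPolynomial.le_totalDegree hm
    rwa [Finsupp.sum_fintype _ _ (fun _ => rfl), Fin.sum_univ_two] at h
  rw [hdeg]
  split_ifs with h
  · simp [h, MvPolynomial.aeval_monomial, Finsupp.prod_fintype, Fin.prod_univ_two]
  · have : f.totalDegree - (m 0 + m 1) ≠ 0 := by omega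
    simp [hv, zero_pow this]

theorem aeval_affineEquation (q : ℕ) (x y : K) :
    MvPolynomial.aeval ![x, y] (affineEquation F q 6 2) =
      ∑ i ∈ Finset.range 6, y ^ q ^ i - (x + x ^ (q ^ 2 + q - 1)) := by
  simp [affineEquation, add_comm q]

theorem homogeneousComponent_X_pow (F : Type*) [Field F] {σ : Type*} (i : σ) (m n : ℕ) :
    MvPolynomial.homogeneousComponent n (MvPolynomial.X i ^ m : MvPolynomial σ F) =
      if m = n then MvPolynomial.X i ^ m else 0 := by
  rw [MvPolynomial.homogeneousComponent_of_mem ((MvPolynomial.mem_homogeneousSubmodule _ _).mpr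
    (MvPolynomial.isHomogeneous_X_pow i m))]
  exact if_congr eq_comm rfl rfl

theorem homogeneousComponent_affineEquation {q : ℕ} (hq : 2 ≤ q) :
    MvPolynomial.homogeneousComponent (q ^ 5) (affineEquation F q 6 2) =
      MvPolynomial.X 1 ^ q ^ 5 := by
  have hpow : ∀ i < 5, q ^ i ≠ q ^ 5 := fun i hi => ne_of_lt (Nat.pow_lt_pow_right hq hi)
  have hx : q ^ 1 + q ^ 2 - 1 ≠ q ^ 5 := by
    have : q ^ 3 < q ^ 5 := Nat.pow_lt_pow_right hq (by norm_num)
    have : q ^ 1 + q ^ 2 ≤ q ^ 3 := by nlinarith [sq_nonneg q]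
    omega
  simp only [affineEquation, map_sub, map_add, map_sum, homogeneousComponent_X_pow]
  rw [Finset.sum_range_succ, Finset.sum_eq_zero fun i hi =>
    if_neg (hpow i (Finset.mem_range.mp hi)), if_pos rfl, Finset.sum_range_one, if_neg (hpow 0 (by norm_num)), if_neg hx]
  simp

theorem totalDegree_affineEquation {q : ℕ} (hq : 2 ≤ q) :
    (affineEquation F q 6 2).totalDegree = q ^ 5 := by
  apply le_antisymm
  · have hpow : ∀ i ≤ 5, q ^ i ≤ q ^ 5 := fun i hi => Nat.pow_le_pow_right (by omega) hi
    have hx : q ^ 1 + q ^ 2 - 1 ≤ q ^ 5 := by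
      have : q ^ 3 ≤ q ^ 5 := hpow 3 (by norm_num)
      have : q ^ 1 + q ^ 2 ≤ q ^ 3 := by nlinarith [sq_nonneg q]
      omega
    refine (MvPolynomial.totalDegree_sub _ _).trans (max_le ?_ ?_)
    · refine (MvPolynomial.totalDegree_finsetSum _ _).trans (Finset.sup_le fun i hi => ?_)
      rw [MvPolynomial.totalDegree_X_pow]
      exact hpow i (by have := Finset.mem_range.mp hi; omega)
    · refine (MvPolynomial.totalDegree_add _ _).trans (max_le ?_ ?_)
      · rw [Finset.sum_range_one, MvPolynomial.totalDegree_X_pow]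
        exact hpow 0 (by norm_num)
      · rwa [MvPolynomial.totalDegree_X_pow]
  · by_contra! h
    have h0 := MvPolynomial.homogeneousComponent_eq_zero _ _ h
    rw [homogeneousComponent_affineEquation hq] at h0
    exact pow_ne_zero _ (MvPolynomial.X_ne_zero _) h0

theorem mk_affine_injective (h1 : ∀ p : K × K, ![p.1, p.2, 1] ≠ 0) :
    Function.Injective fun p : K × K => Projectivization.mk K ![p.1, p.2, 1] (h1 p) := by
  intro p r h
  obtain ⟨a, h⟩ := (Projectivization.mk_eq_mk_iff' _ _ _ _ _).mp h
  have ha : a = 1 := by simpa using congrFun h 2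
  rw [ha, one_smul] at h
  exact Prod.ext (congrFun h 0).symm (congrFun h 1).symm

theorem mk_infinity_ne_mk_affine {x y : K} (h0 : ![(1 : K), 0, 0] ≠ 0) (h1 : ![x, y, 1] ≠ 0) :
    Projectivization.mk K ![1, 0, 0] h0 ≠ Projectivization.mk K ![x, y, 1] h1 := by
  intro h
  obtain ⟨a, h⟩ := (Projectivization.mk_eq_mk_iff' _ _ _ _ _).mp h
  have ha : a = 0 := by simpa using congrFun h 2
  simpa [ha] using congrFun h 0

/-- The only point at infinity is `[1 : 0 : 0]`, since the form of top degree in the equation is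
`y ^ (q ^ 5)`. -/
theorem rationalPoints_eq {q : ℕ} (hq : 2 ≤ q)
    (h1 : ∀ p : K × K, ![p.1, p.2, 1] ≠ 0) (h0 : ![(1 : K), 0, 0] ≠ 0) :
    rationalPoints F K q 6 2 =
      insert (Projectivization.mk K ![1, 0, 0] h0)
        ((fun p : K × K => Projectivization.mk K ![p.1, p.2, 1] (h1 p)) ''
          {p | ∑ i ∈ Finset.range 6, p.2 ^ q ^ i = p.1 + p.1 ^ (q ^ 2 + q - 1)}) := by
  have hq5 : q ^ 5 ≠ 0 := pow_ne_zero _ (by omega)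
  ext P
  induction P using Projectivization.ind with | h v hv => ?_
  rw [Set.mem_insert_iff, Set.mem_image, mk_mem_rationalPoints]
  by_cases h2 : v 2 = 0
  · rw [aeval_homogenization_of_eq_zero _ h2, totalDegree_affineEquation hq,
      homogeneousComponent_affineEquation hq]
    simp only [map_pow, MvPolynomial.aeval_X, Matrix.cons_val_one,
      Matrix.cons_val_fin_one, pow_eq_zero_iff hq5]
    constructor
    · intro hv1
      left
      rw [Projectivization.mk_eq_mk_iff']
      refine ⟨v 0, ?_⟩
      ext i; fin_cases i <;> simp [hv1, h2]
    · rintro (h | ⟨p, -, h⟩)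
      · rw [Projectivization.mk_eq_mk_iff'] at h
        obtain ⟨a, rfl⟩ := h
        simp
      · rw [Projectivization.mk_eq_mk_iff'] at h
        obtain ⟨a, h⟩ := h
        have h' := congrFun h 2
        simp [h2] at h'
  · have hP : Projectivization.mk K v hv =
        Projectivization.mk K ![v 0 / v 2, v 1 / v 2, 1] (h1 (v 0 / v 2, v 1 / v 2)) := by
      rw [Projectivization.mk_eq_mk_iff']
      refine ⟨v 2, ?_⟩
      ext i; fin_cases i <;> simp [mul_div_cancel₀, h2]
    rw [← mk_mem_rationalPoints F K q 6 2 v hv, hP,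
      mk_mem_rationalPoints, aeval_homogenization_of_eq_one _ (by simp)]
    simp only [Matrix.cons_val_zero, Matrix.cons_val_one]
    rw [aeval_affineEquation, sub_eq_zero]
    constructor
    · intro h
      exact Or.inr ⟨(v 0 / v 2, v 1 / v 2), h, rfl⟩
    · rintro (h | ⟨p, hp, h⟩)
      · exact absurd h.symm (mk_infinity_ne_mk_affine h0 (h1 (v 0 / v 2, v 1 / v 2)))
      · obtain rfl : p = (v 0 / v 2, v 1 / v 2) := mk_affine_injective h1 h
        exact hp

theorem ncard_rationalPoints {q : ℕ} [Finite K] (hq : 2 ≤ q) :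
    (rationalPoints F K q 6 2).ncard =
      1 + {p : K × K | ∑ i ∈ Finset.range 6, p.2 ^ q ^ i =
        p.1 + p.1 ^ (q ^ 2 + q - 1)}.ncard := by
  have h1 : ∀ p : K × K, ![p.1, p.2, 1] ≠ 0 := fun p h => by simpa using congrFun h 2
  have h0 : ![(1 : K), 0, 0] ≠ 0 := fun h => by simpa using congrFun h 0
  rw [rationalPoints_eq hq h1 h0, Set.ncard_insert_of_notMem,
    Set.ncard_image_of_injective _ (mk_affine_injective h1), add_comm]
  rintro ⟨p, -, hp⟩
  exact mk_infinity_ne_mk_affine h0 (h1 p) hp.symm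

end Homogenization

end TwistedTrace

theorem mainTheorem1 (F K : Type*) [Field F] [Finite F] [Field K] [Algebra F K]
    (q : ℕ) (hq : Nat.card F = q) (hodd : Odd q) (hK : Module.finrank F K = 6) :
    (TwistedTrace.rationalPoints F K q 6 2).ncard =
      1 + q ^ 7 + (TwistedTrace.bonusFactor q - 1) * (q - 1) * q ^ 5 := by
  have : Module.Finite F K := Module.finite_of_finrank_pos (by omega)
  have : Finite K := Module.finite_of_finite F
  have hq2 : 2 ≤ q := by rw [← hq]; exact Finite.one_lt_card
  rw [TwistedTrace.ncard_rationalPoints hq2,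
    TwistedTrace.ncard_trace_eq hq hK (fun x => x + x ^ (q ^ 2 + q - 1)),
    TwistedTrace.ncard_add_pow_mem_range hq hodd hK, TwistedTrace.bonusFactor_eq_gcd]
  ring
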